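/- Let $R$ be a commutative ring that is a pp-ring: the annihilator of every element $a\in R$ is generated by an idempotent. For every $n\ge 0$ fix a matrix $M_n\in\mathrm{Mat}_{n+1}(\mathbb N)$ that is invertible over $\mathbb Q$ and whose first row has only positive entries, and order $\mathbb Z^{n+1}$, hence the monomials in $X_0,\dots,X_n$, by $$e<_{M_n} f \iff M_n e <_{\mathrm{lex}} M_n f .$$ Let $\mathrm{Frac}\,R$ be the total ring of fractions of $R$ (the localization at all regular elements). For $n\ge 0$ define: - $\operatorname{vdim} R\le n$ if for every $m\geq 0$ and all $x_1,\dots,x_m\in\mathrm{Frac}\,R$, the Krull dimension of the subring $R[x_1,\dots,x_m]$ of $\mathrm{Frac}\,R$ is at most $n$; - $\operatorname{dimv} R\le n$ if for all $x_0,\dots,x_n\in R$ there is a polynomial $P\in R[X_0,\dots,X_n]$ with $P(x_0,\dots,x_n)=0$ whose trailing coefficient for $<_{M_n}$ is $1$, that is, some monomial has coefficient $1$ in $P$ and all $<_{M_n}$-smaller monomials have coefficient $0$. By convention $\operatorname{vdim} R\le -1$ and $\operatorname{dimv} R\le -1$ each mean that $R$ is trivial, and the trivial ring has Krull dimension $-1$.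 **Lemma.** For every integer $d\ge -1$ and every such choice of matrices, $$\operatorname{vdim} R\le d \iff \operatorname{dimv} R\le d .$$ -/

import Mathlib

/-- A pp-ring: the annihilator of every element `a` is generated by an idempotent `1 - e`. -/
def IsPPRing (R : Type*) [CommRing R] : Prop :=
  ∀ a : R, ∃ e : R, IsIdempotentElem e ∧
    (Ideal.span {a}).annihilator = Ideal.span {1 - e}

/-- `vdim R ≤ d` for a pp-ring `R` and an integer `d ≥ -1`. For `d = n ≥ 0`: every subring
`R[x₁, …, xₘ]` of the total ring of fractions `Frac R` generated over `R` by finitely many elements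
has Krull dimension at most `n`. For `d = -1`: the ring is trivial. -/
def VdimLE (R : Type*) [CommRing R] : ℤ → Prop
  | Int.ofNat n => ∀ (m : ℕ) (x : Fin m → FractionRing R),
      ringKrullDim (Algebra.adjoin R (Set.range x)) ≤ (n : WithBot ℕ∞)
  | Int.negSucc 0 => Subsingleton R
  | Int.negSucc (_ + 1) => False

/-- The relation `e <_M f` on `ℤⁿ`: `M e` is lexicographically smaller than `M f`. -/
def MonomialLT {n : ℕ} (M : Matrix (Fin n) (Fin n) ℕ) (e f : Fin n → ℤ) : Prop :=
  toLex ((M.map (fun a : ℕ => (a : ℤ))).mulVec e) <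
    toLex ((M.map (fun a : ℕ => (a : ℤ))).mulVec f)

/-- `M` defines a graded rational monomial order in `n + 1` variables: it is invertible over `ℚ`
and the entries of its first row are positive. -/
def IsGradedRational {n : ℕ} (M : Matrix (Fin (n + 1)) (Fin (n + 1)) ℕ) : Prop :=
  IsUnit (M.map (fun a : ℕ => (a : ℚ))) ∧ ∀ j, 0 < M 0 j

/-- The coefficient of the smallest monomial of `P` for `<_M` is equal to `1`: some monomial has
coefficient `1` in `P` and all smaller monomials have coefficient `0`. -/
def TrailingCoeffOne {R : Type*} [CommRing R] {n : ℕ} (M : Matrix (Fin n) (Fin n) ℕ)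
    (P : MvPolynomial (Fin n) R) : Prop :=
  ∃ e : Fin n →₀ ℕ, P.coeff e = 1 ∧
    ∀ f : Fin n →₀ ℕ, MonomialLT M (fun i => (f i : ℤ)) (fun i => (e i : ℤ)) → P.coeff f = 0

/-- `dimv R ≤ d` for an integer `d ≥ -1`, where `M n` is the matrix of the monomial order that is
used in `n + 1` variables. For `d = n ≥ 0`: any `x₀, …, xₙ` in `R` are a zero of some polynomial
over `R` with trailing coefficient `1`. For `d = -1`: the ring is trivial. -/
def DimvLE (M : ∀ n : ℕ, Matrix (Fin (n + 1)) (Fin (n + 1)) ℕ) (R : Type*) [CommRing R] :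
    ℤ → Prop
  | Int.ofNat n => ∀ x : Fin (n + 1) → R, ∃ P : MvPolynomial (Fin (n + 1)) R,
      MvPolynomial.eval x P = 0 ∧ TrailingCoeffOne (M n) P
  | Int.negSucc 0 => Subsingleton R
  | Int.negSucc (_ + 1) => False

/-! The bridge is a first-order description of Krull dimension
(`ringKrullDim_le_iff_forall_mem_lexIdeal`): dim A ≤ n iff for all z₀, …, zₙ in A some monomial z^k
is a combination of lexicographically larger ones. Since e <_M f compares M e and M f
lexicographically, the substitution x_j = ∏ z_i^(M i j), which turns x^f into z^(M f), translates
<_M-relations for x into lexicographic relations for z. From dimv to vdim, the z_i are fractions. A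
power of a common denominator b puts the x_j into R, and b cancels again because the first row of M
grades the monomials. From vdim to dimv, regular x_j are units of Frac R, so the substitution can be
inverted up to a scalar D by Laurent monomials; a lexicographic relation between these, divided by
its smallest term and then cleared of denominators, is the required polynomial. The pp-condition
reduces arbitrary x_j to regular ones. -/

theorem toLex_cons_lt_cons_iff {α : Type*} [Preorder α] {n : ℕ} {a b : α} {k f : Fin n → α} :
    toLex (Fin.cons a k : Fin (n + 1) → α) < toLex (Fin.cons b f : Fin (n + 1) → α) ↔
      a < b ∨ a = b ∧ toLex k < toLex f :=
  Fin.pi_lex_lt_cons_cons (α := fun _ => α) (fun a b => a < b)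

/-- The ideal generated by the monomials in `z` whose exponent is lexicographically larger
than `k`. -/
def lexIdeal {A : Type*} [CommRing A] {n : ℕ} (z : Fin n → A) (k : Fin n → ℕ) : Ideal A :=
  Ideal.span {y | ∃ f : Fin n → ℕ, toLex k < toLex f ∧ ∏ i, z i ^ f i = y}

/-! ### Krull dimension and lexicographic relations -/

section LexIdeal

variable {A : Type*} [CommRing A] {n : ℕ}

theorem prod_pow_mem_lexIdeal (z : Fin n → A) {k f : Fin n → ℕ} (h : toLex k < toLex f) :
    ∏ i, z i ^ f i ∈ lexIdeal z k :=
  Ideal.subset_span ⟨f, h, rfl⟩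

theorem prod_pow_add (z : Fin n → A) (k f : Fin n → ℕ) :
    ∏ i, z i ^ (k + f) i = (∏ i, z i ^ k i) * ∏ i, z i ^ f i := by
  simp [pow_add, Finset.prod_mul_distrib]

theorem prod_pow_mul_mem_lexIdeal (z : Fin n → A) {k l : Fin n → ℕ} {s : A}
    (hs : s ∈ lexIdeal z l) : (∏ i, z i ^ k i) * s ∈ lexIdeal z (k + l) := by
  unfold lexIdeal at hs
  induction hs using Submodule.span_induction with
  | mem y hy =>
    obtain ⟨f, hf, rfl⟩ := hy
    rw [← prod_pow_add]
    exact prod_pow_mem_lexIdeal z (by simpa [toLex_add] using hf)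
  | zero => simp
  | add x y _ _ hx hy => rw [mul_add]; exact add_mem hx hy
  | smul a x _ hx =>
    rw [smul_eq_mul, mul_left_comm]
    exact Ideal.mul_mem_left _ _ hx

theorem mul_mem_lexIdeal (z : Fin n → A) {k l : Fin n → ℕ} {s t : A}
    (hs : s ∈ lexIdeal z k) (ht : t ∈ lexIdeal z l) : s * t ∈ lexIdeal z (k + l) := by
  unfold lexIdeal at hs
  induction hs using Submodule.span_induction with
  | mem y hy =>
    obtain ⟨f, hf, rfl⟩ := hy
    have hfl := prod_pow_mul_mem_lexIdeal z (k := f) ht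
    refine Ideal.span_mono ?_ hfl
    rintro _ ⟨g, hg, rfl⟩
    have hkf : toLex (k + l) < toLex (f + l) := by simpa [toLex_add] using hf
    exact ⟨g, hkf.trans hg, rfl⟩
  | zero => simp
  | add x y _ _ hx hy => rw [add_mul]; exact add_mem hx hy
  | smul a x _ hx =>
    rw [smul_mul_assoc]
    exact Submodule.smul_mem _ _ hx

/-- The elements of the form monomial in `z` plus lexicographically larger terms. -/
def lexMonoid (z : Fin n → A) : Submonoid A where
  carrier := {x | ∃ k : Fin n → ℕ, ∃ s ∈ lexIdeal z k, x = ∏ i, z i ^ k i + s}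
  one_mem' := ⟨0, 0, zero_mem _, by simp⟩
  mul_mem' := by
    rintro _ _ ⟨k, s, hs, rfl⟩ ⟨l, t, ht, rfl⟩
    refine ⟨k + l, (∏ i, z i ^ k i) * t + (∏ i, z i ^ l i) * s + s * t, ?_, ?_⟩
    · refine add_mem (add_mem (prod_pow_mul_mem_lexIdeal z ht) ?_) (mul_mem_lexIdeal z hs ht)
      rw [add_comm k l]
      exact prod_pow_mul_mem_lexIdeal z hs
    · rw [prod_pow_add]; ring

theorem zero_mem_lexMonoid_iff (z : Fin n → A) :
    (0 : A) ∈ lexMonoid z ↔ ∃ k : Fin n → ℕ, ∏ i, z i ^ k i ∈ lexIdeal z k := by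
  constructor
  · rintro ⟨k, s, hs, h⟩
    refine ⟨k, ?_⟩
    rw [eq_neg_of_add_eq_zero_left h.symm]
    exact neg_mem hs
  · rintro ⟨k, hk⟩
    exact ⟨k, _, neg_mem hk, by simp⟩

theorem lexIdeal_tail_le (z : Fin (n + 1) → A) (k : Fin n → ℕ) :
    lexIdeal (Fin.tail z) k ≤ lexIdeal z (Fin.cons 0 k) := by
  refine Ideal.span_le.2 ?_
  rintro _ ⟨f, hf, rfl⟩
  have h := prod_pow_mem_lexIdeal z (k := Fin.cons 0 k) (f := Fin.cons 0 f)
    (toLex_cons_lt_cons_iff.2 (Or.inr ⟨rfl, hf⟩))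
  simpa [Fin.prod_univ_succ, Fin.tail] using h

theorem lexIdeal_le_mul (z : Fin (n + 1) → A) (a : ℕ) (k : Fin n → ℕ) :
    lexIdeal z (Fin.cons a k) ≤
      Ideal.span {z 0 ^ a} * (lexIdeal (Fin.tail z) k ⊔ Ideal.span {z 0}) := by
  refine Ideal.span_le.2 ?_
  rintro _ ⟨f, hf, rfl⟩
  rw [← Fin.cons_self_tail f, toLex_cons_lt_cons_iff] at hf
  rw [Fin.prod_univ_succ]
  rcases hf with h | ⟨rfl, h⟩
  · obtain ⟨c, hc⟩ := Nat.exists_eq_add_of_lt h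
    rw [hc, SetLike.mem_coe, Ideal.mem_span_singleton_mul]
    refine ⟨z 0 ^ (c + 1) * ∏ i : Fin n, z i.succ ^ f i.succ, ?_, by ring⟩
    refine Ideal.mem_sup_right (Ideal.mul_mem_right _ _ ?_)
    exact Ideal.mem_span_singleton.2 (dvd_pow_self _ (by simp))
  · exact Ideal.mul_mem_mul (Ideal.mem_span_singleton_self _)
      (Ideal.mem_sup_left (prod_pow_mem_lexIdeal (Fin.tail z) h))

theorem self_mem_lexMonoid (z : Fin (n + 1) → A) : z 0 ∈ lexMonoid z :=
  ⟨Fin.cons 1 0, 0, zero_mem _, by simp [Fin.prod_univ_succ]⟩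

theorem add_mul_mem_lexMonoid (z : Fin (n + 1) → A) {t : A} (ht : t ∈ lexMonoid (Fin.tail z))
    (a : A) : t + a * z 0 ∈ lexMonoid z := by
  obtain ⟨k, s, hs, rfl⟩ := ht
  refine ⟨Fin.cons 0 k, s + a * z 0, add_mem (lexIdeal_tail_le z k hs) ?_, ?_⟩
  · refine Ideal.mul_mem_left _ _ ?_
    have h := prod_pow_mem_lexIdeal z (k := Fin.cons 0 k) (f := Fin.cons 1 0)
      (toLex_cons_lt_cons_iff.2 (Or.inl one_pos))
    simpa [Fin.prod_univ_succ] using h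
  · simp [Fin.prod_univ_succ, Fin.tail, add_assoc]

theorem exists_of_mem_lexMonoid (z : Fin (n + 1) → A) {x : A} (hx : x ∈ lexMonoid z) :
    ∃ (m : ℕ) (a : A), ∃ t ∈ lexMonoid (Fin.tail z), x = z 0 ^ m * (t + a * z 0) := by
  obtain ⟨k, s, hs, rfl⟩ := hx
  rw [← Fin.cons_self_tail k] at hs
  obtain ⟨u, hu, rfl⟩ := Ideal.mem_span_singleton_mul.1 (lexIdeal_le_mul z _ _ hs)
  obtain ⟨v, hv, w, hw, rfl⟩ := Submodule.mem_sup.1 hu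
  obtain ⟨a, rfl⟩ := Ideal.mem_span_singleton'.1 hw
  refine ⟨k 0, a, _, ⟨Fin.tail k, v, hv, rfl⟩, ?_⟩
  rw [Fin.prod_univ_succ]
  simp only [Fin.tail]
  ring

/-- A prime p ⊇ I avoiding the monoid does not contain z₀. Moreover p + (z₀) avoids the monoid of
the remaining z's, since t = q + a z₀ with q ∈ p would put t - a z₀ in both p and the monoid.
Induction continues from p + (z₀). -/
theorem exists_ltSeries_of_disjoint_lexMonoid (z : Fin n → A) (I : Ideal A)
    (h : Disjoint (I : Set A) (lexMonoid z)) :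
    ∃ l : LTSeries (PrimeSpectrum A), l.length = n ∧ I ≤ l.head.asIdeal := by
  induction n generalizing I with
  | zero =>
    obtain ⟨p, hp, hIp, -⟩ := Ideal.exists_le_prime_disjoint I _ h
    exact ⟨RelSeries.singleton _ ⟨p, hp⟩, rfl, hIp⟩
  | succ n ih =>
    obtain ⟨p, hp, hIp, hd⟩ := Ideal.exists_le_prime_disjoint I _ h
    have hdis : Disjoint ((p ⊔ Ideal.span {z 0} : Ideal A) : Set A)
        (lexMonoid (Fin.tail z)) := by
      rw [Set.disjoint_left]
      intro t ht htM
      obtain ⟨q, hq, w, hw, rfl⟩ := Submodule.mem_sup.1 ht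
      obtain ⟨a, rfl⟩ := Ideal.mem_span_singleton'.1 hw
      refine Set.disjoint_left.1 hd hq ?_
      simpa using add_mul_mem_lexMonoid z htM (-a)
    obtain ⟨l, hl, hle⟩ := ih (Fin.tail z) _ hdis
    have hlt : (⟨p, hp⟩ : PrimeSpectrum A) < l.head := by
      refine lt_of_le_of_ne (le_sup_left.trans hle) fun heq => ?_
      have hz : z 0 ∈ l.head.asIdeal :=
        hle (Ideal.mem_sup_right (Ideal.mem_span_singleton_self _))
      rw [← heq] at hz
      exact Set.disjoint_left.1 hd hz (self_mem_lexMonoid z)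
    exact ⟨l.cons ⟨p, hp⟩ hlt, by simp [hl], by simpa using hIp⟩

/-- Each new element y is chosen in the next prime but outside p. If y^m (t + a y) lies in p, then
so does t + a y, hence t lies in the next prime, against the induction hypothesis. -/
theorem exists_disjoint_lexMonoid_of_ltSeries (l : LTSeries (PrimeSpectrum A))
    (hl : l.length = n) :
    ∃ z : Fin n → A, Disjoint (l.head.asIdeal : Set A) (lexMonoid z) := by
  induction l using RelSeries.inductionOn generalizing n with
  | singleton p =>
    obtain rfl : n = 0 := by simpa using hl.symm
    refine ⟨Fin.elim0, Set.disjoint_left.2 ?_⟩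
    rintro _ hx ⟨k, s, hs, rfl⟩
    have hs0 : s = 0 := by
      have : lexIdeal (Fin.elim0 : Fin 0 → A) k = ⊥ := by
        refine Ideal.span_eq_bot.2 ?_
        rintro _ ⟨f, hf, rfl⟩
        rw [Subsingleton.elim k f] at hf
        exact absurd hf (lt_irrefl _)
      simpa [this] using hs
    exact p.2.ne_top ((Ideal.eq_top_iff_one _).2 (by simpa [hs0] using hx))
  | cons l p hp ih =>
    obtain ⟨n, rfl⟩ : ∃ m, n = m + 1 := ⟨l.length, by simpa using hl.symm⟩
    obtain ⟨z, hz⟩ := ih (n := n) (by simpa using hl)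
    have hp' : p < l.head := hp
    obtain ⟨y, hy, hyp⟩ := SetLike.exists_of_lt
      (show p.asIdeal < l.head.asIdeal from hp')
    refine ⟨Fin.cons y z, Set.disjoint_left.2 ?_⟩
    intro x hx hxM
    rw [RelSeries.head_cons] at hx
    obtain ⟨m, a, t, ht, rfl⟩ := exists_of_mem_lexMonoid _ hxM
    rw [Fin.cons_zero] at hx
    rw [Fin.tail_cons] at ht
    rcases p.2.mem_or_mem hx with h | h
    · exact hyp (p.2.mem_of_pow_mem _ h)
    · refine Set.disjoint_left.1 hz ?_ ht
      have h2 : t + a * y ∈ l.head.asIdeal := hp'.le h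
      exact (Ideal.add_mem_iff_left _ (Ideal.mul_mem_left _ _ hy)).1 h2

end LexIdeal

/-- The Krull dimension is at most `n` if and only if any `n + 1` elements satisfy a polynomial
relation whose lexicographically smallest term has coefficient `1`. -/
theorem ringKrullDim_le_iff_forall_mem_lexIdeal (A : Type*) [CommRing A] (n : ℕ) :
    ringKrullDim A ≤ (n : WithBot ℕ∞) ↔
      ∀ z : Fin (n + 1) → A, ∃ k : Fin (n + 1) → ℕ, ∏ i, z i ^ k i ∈ lexIdeal z k := by
  simp only [← zero_mem_lexMonoid_iff]
  have key : ¬ ringKrullDim A ≤ (n : WithBot ℕ∞) ↔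
      ∃ l : LTSeries (PrimeSpectrum A), l.length = n + 1 := by
    rw [not_le, ← ENat.WithBot.add_one_le_iff, ← Order.le_krullDim_iff]
    simp [ringKrullDim]
  rw [← not_iff_not, key]
  push Not
  constructor
  · rintro ⟨l, hl⟩
    obtain ⟨z, hz⟩ := exists_disjoint_lexMonoid_of_ltSeries l hl
    exact ⟨z, Set.disjoint_left.1 hz (zero_mem _)⟩
  · rintro ⟨z, hz⟩
    obtain ⟨l, hl, -⟩ := exists_ltSeries_of_disjoint_lexMonoid z ⊥ (by simpa using hz)
    exact ⟨l, hl⟩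

/-! ### The monomial order of a matrix -/

section MonomialOrder

open Matrix

theorem det_map_intCast_ne_zero {n : ℕ} {M : Matrix (Fin (n + 1)) (Fin (n + 1)) ℕ}
    (hM : IsGradedRational M) : (M.map (fun a : ℕ => (a : ℤ))).det ≠ 0 := by
  have h := (Matrix.isUnit_iff_isUnit_det _).1 hM.1
  intro h0
  have h1 : (M.map (fun a : ℕ => (a : ℚ))).det
      = ((M.map (fun a : ℕ => (a : ℤ))).det : ℚ) := by
    rw [Int.cast_det]
    congr 1
  rw [h1, h0] at h
  simp at h

theorem monomialLT_trans {n : ℕ} {M : Matrix (Fin n) (Fin n) ℕ} {e f g : Fin n → ℤ}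
    (h₁ : MonomialLT M e f) (h₂ : MonomialLT M f g) : MonomialLT M e g :=
  lt_trans h₁ h₂

theorem not_monomialLT_self {n : ℕ} {M : Matrix (Fin n) (Fin n) ℕ} (e : Fin n → ℤ) :
    ¬ MonomialLT M e e :=
  lt_irrefl _

theorem monomialLT_add_right_iff {n : ℕ} {M : Matrix (Fin n) (Fin n) ℕ} (e g : Fin n → ℤ) :
    MonomialLT M e (e + g) ↔ MonomialLT M 0 g := by
  unfold MonomialLT
  rw [Matrix.mulVec_add, Matrix.mulVec_zero, toLex_add, toLex_zero, lt_add_iff_pos_right]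

theorem MonomialLT.add {n : ℕ} {M : Matrix (Fin n) (Fin n) ℕ} {e f : Fin n → ℤ}
    (he : MonomialLT M 0 e) (hf : MonomialLT M 0 f) : MonomialLT M 0 (e + f) :=
  monomialLT_trans he ((monomialLT_add_right_iff e f).2 hf)

theorem monomialLT_or_gt_of_ne {n : ℕ} {M : Matrix (Fin (n + 1)) (Fin (n + 1)) ℕ}
    (hM : IsGradedRational M) {e f : Fin (n + 1) → ℤ} (h : e ≠ f) :
    MonomialLT M e f ∨ MonomialLT M f e := by
  refine lt_or_gt_of_ne fun heq => h ?_
  have h0 := Matrix.eq_zero_of_mulVec_eq_zero (det_map_intCast_ne_zero hM) (v := e - f)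
    (by rw [Matrix.mulVec_sub, sub_eq_zero]; exact toLex.injective heq)
  exact sub_eq_zero.1 h0

theorem exists_mul_eq_smul_one {n : ℕ} {M : Matrix (Fin (n + 1)) (Fin (n + 1)) ℕ}
    (hM : IsGradedRational M) :
    ∃ (N : Matrix (Fin (n + 1)) (Fin (n + 1)) ℤ) (D : ℤ), 0 < D ∧
      M.map (fun a : ℕ => (a : ℤ)) * N = D • (1 : Matrix (Fin (n + 1)) (Fin (n + 1)) ℤ) := by
  set W := M.map (fun a : ℕ => (a : ℤ))
  have hW : W.det ≠ 0 := det_map_intCast_ne_zero hM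
  -- The extra factor `W.det` makes the scalar a square, hence positive, so that it preserves the
  -- order.
  refine ⟨W.det • W.adjugate, W.det * W.det, mul_self_pos.2 hW, ?_⟩
  rw [Matrix.mul_smul, Matrix.mul_adjugate, smul_smul]

end MonomialOrder

/-! ### From dimv to vdim -/

theorem TrailingCoeffOne.exists_forall_support {R : Type*} [CommRing R] {n : ℕ}
    {M : Matrix (Fin (n + 1)) (Fin (n + 1)) ℕ} (hM : IsGradedRational M)
    {P : MvPolynomial (Fin (n + 1)) R} (hP : TrailingCoeffOne M P) :
    ∃ e : Fin (n + 1) →₀ ℕ, ∀ f ∈ (P - MvPolynomial.monomial e 1).support,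
      MonomialLT M (fun i => (e i : ℤ)) (fun i => (f i : ℤ)) := by
  classical
  obtain ⟨e, he, hf⟩ := hP
  refine ⟨e, fun f hfs => ?_⟩
  rw [MvPolynomial.mem_support_iff, MvPolynomial.coeff_sub, MvPolynomial.coeff_monomial] at hfs
  have hef : e ≠ f := by
    rintro rfl
    simp [he] at hfs
  have hne : (fun i => (e i : ℤ)) ≠ fun i => (f i : ℤ) := by
    intro h
    exact hef (Finsupp.ext fun i => by simpa using congrFun h i)
  rcases monomialLT_or_gt_of_ne hM hne with h | h
  · exact h
  · simp [hef, hf f h] at hfs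

theorem prod_prod_pow_pow {A ι κ : Type*} [CommMonoid A] [Fintype ι] [Fintype κ]
    (M : Matrix ι κ ℕ) (z : ι → A) (f : κ → ℕ) :
    ∏ j, (∏ i, z i ^ M i j) ^ f j = ∏ i, z i ^ M.mulVec f i := by
  simp only [← Finset.prod_pow, ← pow_mul]
  rw [Finset.prod_comm]
  refine Finset.prod_congr rfl fun i _ => ?_
  rw [Finset.prod_pow_eq_pow_sum]
  rfl

theorem monomialLT_natCast_iff {n : ℕ} {M : Matrix (Fin n) (Fin n) ℕ} {e f : Fin n → ℕ} :
    MonomialLT M (fun i => (e i : ℤ)) (fun i => (f i : ℤ)) ↔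
      toLex (M.mulVec e) < toLex (M.mulVec f) := by
  have h : ∀ g : Fin n → ℕ, (M.map (fun a : ℕ => (a : ℤ))).mulVec (fun i => (g i : ℤ))
      = fun i => (M.mulVec g i : ℤ) := by
    intro g
    ext i
    simp [Matrix.mulVec, dotProduct]
  unfold MonomialLT
  rw [h, h]
  change (∃ i, _ ∧ _) ↔ ∃ i, _ ∧ _
  simp

theorem apply_zero_le_of_toLex_lt {n : ℕ} {k f : Fin (n + 1) → ℕ} (h : toLex k < toLex f) :
    k 0 ≤ f 0 := by
  rw [← Fin.cons_self_tail k, ← Fin.cons_self_tail f, toLex_cons_lt_cons_iff] at h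
  rcases h with h | h
  · exact h.le
  · exact h.1.le

/-- A polynomial relation with trailing coefficient `1` for the elements
`b ^ (N * M 0 j) * ∏ i, z i ^ M i j` gives a lexicographic relation for the `z i`. -/
theorem exists_prod_pow_mem_lexIdeal {R A : Type*} [CommRing R] [CommRing A] [Algebra R A] {n : ℕ}
    {M : Matrix (Fin (n + 1)) (Fin (n + 1)) ℕ} (hM : IsGradedRational M)
    {b : A} (hb : b ∈ nonZeroDivisors A) (N : ℕ) (z : Fin (n + 1) → A)
    {P : MvPolynomial (Fin (n + 1)) R} (hP : TrailingCoeffOne M P)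
    (h0 : MvPolynomial.aeval (fun j => b ^ (N * M 0 j) * ∏ i, z i ^ M i j) P = 0) :
    ∃ k : Fin (n + 1) → ℕ, ∏ i, z i ^ k i ∈ lexIdeal z k := by
  obtain ⟨e, he⟩ := hP.exists_forall_support hM
  set x : Fin (n + 1) → A := fun j => b ^ (N * M 0 j) * ∏ i, z i ^ M i j
  have hx : ∀ f : Fin (n + 1) → ℕ,
      ∏ j, x j ^ f j = b ^ (N * M.mulVec f 0) * ∏ i, z i ^ M.mulVec f i := by
    intro f
    simp only [x, mul_pow, Finset.prod_mul_distrib, prod_prod_pow_pow]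
    congr 1
    simp only [← pow_mul]
    rw [Finset.prod_pow_eq_pow_sum]
    simp [Matrix.mulVec, dotProduct, Finset.mul_sum, mul_assoc]
  set k := M.mulVec e
  -- A lexicographically larger exponent has first entry at least `k 0`, so the power of b in the
  -- trailing term divides every other term.
  have hQ : MvPolynomial.aeval x (P - MvPolynomial.monomial e 1) ∈
      Ideal.span {b ^ (N * k 0)} * lexIdeal z k := by
    rw [MvPolynomial.aeval_def, MvPolynomial.eval₂_eq']
    refine sum_mem fun f hf => ?_
    have hlt := monomialLT_natCast_iff.1 (he f hf)
    rw [hx]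
    refine Ideal.mul_mem_left _ _ (Ideal.mul_mem_mul ?_ (prod_pow_mem_lexIdeal z hlt))
    exact Ideal.mem_span_singleton.2
      (pow_dvd_pow _ (Nat.mul_le_mul_left _ (apply_zero_le_of_toLex_lt hlt)))
  obtain ⟨s, hs, hsQ⟩ := Ideal.mem_span_singleton_mul.1 hQ
  rw [map_sub, h0, MvPolynomial.aeval_monomial, map_one, one_mul, zero_sub,
    Finsupp.prod_fintype _ _ (fun i => pow_zero _), hx] at hsQ
  refine ⟨k, ?_⟩
  have hz : ∏ i, z i ^ k i + s = 0 := by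
    have : (∏ i, z i ^ k i + s) * b ^ (N * k 0) = 0 := by
      rw [add_mul, mul_comm s, hsQ, mul_comm]
      exact add_neg_cancel _
    exact (mul_right_mem_nonZeroDivisors_eq_zero_iff (pow_mem hb _)).1 this
  rw [eq_neg_of_add_eq_zero_left hz]
  exact neg_mem hs

theorem vdimLE_of_dimvLE {R : Type*} [CommRing R]
    (M : ∀ n : ℕ, Matrix (Fin (n + 1)) (Fin (n + 1)) ℕ) (hM : ∀ n, IsGradedRational (M n))
    (n : ℕ) (h : DimvLE M R (n : ℤ)) : VdimLE R (n : ℤ) := by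
  intro m y
  rw [ringKrullDim_le_iff_forall_mem_lexIdeal]
  -- Only the inclusion of A in Frac R matters from here on.
  generalize Algebra.adjoin R (Set.range y) = A
  intro z
  obtain ⟨b, hb⟩ := IsLocalization.exist_integer_multiples_of_finite (nonZeroDivisors R)
    (fun i => (z i : FractionRing R))
  choose w hw using hb
  have hwA : ∀ i, algebraMap R A (w i) = algebraMap R A b * z i := by
    intro i
    apply Subtype.ext
    refine (hw i).trans ?_
    rw [Algebra.smul_def]
    rfl
  have hbA : algebraMap R A b ∈ nonZeroDivisors A := by
    have hu : IsUnit (algebraMap R (FractionRing R) b) := IsLocalization.map_units _ b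
    rw [mem_nonZeroDivisors_iff_right]
    intro a ha
    apply Subtype.ext
    have h1 : (a : FractionRing R) * algebraMap R (FractionRing R) b = 0 := congrArg Subtype.val ha
    exact (hu.mul_left_eq_zero).1 h1
  -- Positivity of the first row lets one N work for all j: b^(N * M 0 j) clears the denominators of
  -- ∏ z_i^(M i j).
  set N := ∑ j, ∑ i, M n i j
  have hN : ∀ j, ∑ i, M n i j ≤ N * M n 0 j := fun j =>
    (Finset.single_le_sum (f := fun j => ∑ i, M n i j) (fun _ _ => Nat.zero_le _)
      (Finset.mem_univ j)).trans (Nat.le_mul_of_pos_right _ ((hM n).2 j))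
  let x : Fin (n + 1) → R := fun j =>
    (b : R) ^ (N * M n 0 j - ∑ i, M n i j) * ∏ i, w i ^ M n i j
  have hx : (fun j => algebraMap R A (x j)) =
      fun j => algebraMap R A b ^ (N * M n 0 j) * ∏ i, z i ^ M n i j := by
    ext1 j
    simp only [x, map_mul, map_pow, map_prod, hwA, mul_pow, Finset.prod_mul_distrib]
    rw [Finset.prod_pow_eq_pow_sum, ← mul_assoc, ← pow_add, Nat.sub_add_cancel (hN j)]
  obtain ⟨P, hP0, hP⟩ := h x
  refine exists_prod_pow_mem_lexIdeal (hM n) hbA N z hP ?_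
  rw [← hx]
  have := congrArg (algebraMap R A) hP0
  rw [map_zero] at this
  rw [← this]
  exact MvPolynomial.aeval_algebraMap_apply A x P

/-- The Laurent monomial in the units `u` with exponent `g`. -/
def laurentMonomial {K : Type*} [CommRing K] {n : ℕ} (u : Fin n → Kˣ) (g : Fin n → ℤ) : Kˣ :=
  ∏ j, u j ^ g j

/-- The span of the Laurent monomials in `u` whose exponents are positive for `<_M`. -/
def positiveSpan (R : Type*) {K : Type*} [CommRing R] [CommRing K] [Algebra R K] {n : ℕ}
    (M : Matrix (Fin n) (Fin n) ℕ) (u : Fin n → Kˣ) : Submodule R K :=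
  Submodule.span R {y | ∃ g : Fin n → ℤ, MonomialLT M 0 g ∧ (laurentMonomial u g : K) = y}

/-! ### Laurent monomials and positive spans -/

section Laurent

variable {R K : Type*} [CommRing R] [CommRing K] [Algebra R K] {n : ℕ}

theorem laurentMonomial_add (u : Fin n → Kˣ) (g h : Fin n → ℤ) :
    laurentMonomial u (g + h) = laurentMonomial u g * laurentMonomial u h := by
  simp [laurentMonomial, zpow_add, Finset.prod_mul_distrib]

theorem laurentMonomial_zero (u : Fin n → Kˣ) : laurentMonomial u 0 = 1 := by
  simp [laurentMonomial]

theorem laurentMonomial_natCast (u : Fin n → Kˣ) (f : Fin n → ℕ) :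
    (laurentMonomial u (fun i => (f i : ℤ)) : K) = ∏ i, (u i : K) ^ f i := by
  simp [laurentMonomial]

theorem prod_laurentMonomial_pow (u : Fin n → Kˣ) (N : Matrix (Fin n) (Fin n) ℤ)
    (k : Fin n → ℕ) :
    ∏ i, laurentMonomial u (fun j => N j i) ^ k i
      = laurentMonomial u (N.mulVec fun i => (k i : ℤ)) := by
  simp only [laurentMonomial, ← zpow_natCast, ← Finset.prod_zpow, ← zpow_mul]
  rw [Finset.prod_comm]
  refine Finset.prod_congr rfl fun j _ => ?_
  rw [Matrix.mulVec, dotProduct]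
  induction (Finset.univ : Finset (Fin n)) using Finset.cons_induction with
  | empty => simp
  | cons a s ha ih => rw [Finset.prod_cons, Finset.sum_cons, zpow_add, ih]

theorem laurentMonomial_mul_mem_positiveSpan {M : Matrix (Fin n) (Fin n) ℕ} (u : Fin n → Kˣ)
    {g : Fin n → ℤ} (hg : MonomialLT M 0 g) {l : K} (hl : l ∈ positiveSpan R M u) :
    (laurentMonomial u g : K) * l ∈ positiveSpan R M u := by
  unfold positiveSpan at hl
  induction hl using Submodule.span_induction with
  | mem y hy =>
    obtain ⟨h, hh, rfl⟩ := hy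
    exact Submodule.subset_span ⟨g + h, hg.add hh, by rw [laurentMonomial_add, Units.val_mul]⟩
  | zero => simp
  | add x y _ _ hx hy => rw [mul_add]; exact add_mem hx hy
  | smul a x _ hx => rw [mul_smul_comm]; exact Submodule.smul_mem _ _ hx

theorem mul_mem_positiveSpan_of_mem_adjoin {M : Matrix (Fin n) (Fin n) ℕ} (u : Fin n → Kˣ)
    {s : Set K} (hs : ∀ y ∈ s, ∃ g : Fin n → ℤ, MonomialLT M 0 g ∧ (laurentMonomial u g : K) = y)
    {a : K} (ha : a ∈ Algebra.adjoin R s) {l : K} (hl : l ∈ positiveSpan R M u) :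
    a * l ∈ positiveSpan R M u := by
  induction ha using Algebra.adjoin_induction generalizing l with
  | mem y hy =>
    obtain ⟨g, hg, rfl⟩ := hs y hy
    exact laurentMonomial_mul_mem_positiveSpan u hg hl
  | algebraMap r => rw [← Algebra.smul_def]; exact Submodule.smul_mem _ _ hl
  | add x y _ _ hx hy => rw [add_mul]; exact add_mem (hx hl) (hy hl)
  | mul x y _ _ hx hy => rw [mul_assoc]; exact hx (hy hl)

/-- Clearing denominators: after multiplication by a large monomial, an element of the positive
span becomes a polynomial with large exponents only. -/
theorem exists_aeval_eq_of_mem_positiveSpan {M : Matrix (Fin n) (Fin n) ℕ} (u : Fin n → Kˣ)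
    {l : K} (hl : l ∈ positiveSpan R M u) :
    ∃ E : Fin n → ℕ, ∀ e : Fin n → ℕ, E ≤ e → ∃ P : MvPolynomial (Fin n) R,
      MvPolynomial.aeval (fun i => (u i : K)) P = (∏ i, (u i : K) ^ e i) * l ∧
      ∀ f, P.coeff f ≠ 0 → MonomialLT M (fun i => (e i : ℤ)) (fun i => (f i : ℤ)) := by
  classical
  unfold positiveSpan at hl
  induction hl using Submodule.span_induction with
  | mem y hy =>
    obtain ⟨g, hg, rfl⟩ := hy
    -- The negative part of g: any e above it makes e + g a genuine exponent.
    refine ⟨fun i => (-g i).toNat, fun e he => ?_⟩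
    let h : Fin n →₀ ℕ := Finsupp.equivFunOnFinite.symm fun i => ((e i : ℤ) + g i).toNat
    have hh : (fun i => (h i : ℤ)) = (fun i => (e i : ℤ)) + g := by
      ext i
      have hi : (-g i).toNat ≤ e i := he i
      simp only [h, Finsupp.coe_equivFunOnFinite_symm, Pi.add_apply]
      omega
    refine ⟨MvPolynomial.monomial h 1, ?_, fun f hf => ?_⟩
    · rw [MvPolynomial.aeval_monomial, map_one, one_mul,
        Finsupp.prod_fintype _ _ (fun i => pow_zero _), ← laurentMonomial_natCast, hh,
        laurentMonomial_add, Units.val_mul, laurentMonomial_natCast]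
    · rw [MvPolynomial.coeff_monomial] at hf
      obtain rfl : h = f := by
        by_contra hne
        simp [hne] at hf
      rw [hh]
      exact (monomialLT_add_right_iff _ _).2 hg
  | zero => exact ⟨0, fun e _ => ⟨0, by simp, by simp⟩⟩
  | add x y _ _ hx hy =>
    obtain ⟨E, hE⟩ := hx
    obtain ⟨F, hF⟩ := hy
    refine ⟨E ⊔ F, fun e he => ?_⟩
    obtain ⟨P, hP, hP'⟩ := hE e (le_sup_left.trans he)
    obtain ⟨Q, hQ, hQ'⟩ := hF e (le_sup_right.trans he)
    refine ⟨P + Q, by rw [map_add, hP, hQ, mul_add], fun f hf => ?_⟩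
    by_cases h : P.coeff f = 0
    · exact hQ' f (by simpa [h] using hf)
    · exact hP' f h
  | smul a x _ hx =>
    obtain ⟨E, hE⟩ := hx
    refine ⟨E, fun e he => ?_⟩
    obtain ⟨P, hP, hP'⟩ := hE e he
    refine ⟨a • P, by rw [map_smul, hP, mul_smul_comm], fun f hf => hP' f fun h => hf ?_⟩
    rw [MvPolynomial.coeff_smul, h, smul_zero]

/-- Multiplying the expression of 1 by a large monomial u^E gives u^E = Q(u) with all monomials of Q
larger than X^E; then X^E - Q is the relation. -/
theorem exists_trailingCoeffOne_of_one_mem_positiveSpan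
    (hinj : Function.Injective (algebraMap R K)) {M : Matrix (Fin n) (Fin n) ℕ} (x : Fin n → R)
    (u : Fin n → Kˣ) (hu : ∀ i, (u i : K) = algebraMap R K (x i))
    (h1 : (1 : K) ∈ positiveSpan R M u) :
    ∃ P : MvPolynomial (Fin n) R, MvPolynomial.eval x P = 0 ∧ TrailingCoeffOne M P := by
  classical
  obtain ⟨E, hE⟩ := exists_aeval_eq_of_mem_positiveSpan u h1
  obtain ⟨Q, hQ, hQ'⟩ := hE E le_rfl
  let e : Fin n →₀ ℕ := Finsupp.equivFunOnFinite.symm E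
  refine ⟨MvPolynomial.monomial e 1 - Q, ?_, e, ?_, fun f hf => ?_⟩
  · apply hinj
    rw [map_zero, map_sub, map_sub, sub_eq_zero]
    have hQx : algebraMap R K (MvPolynomial.eval x Q)
        = MvPolynomial.aeval (fun i => (u i : K)) Q := by
      simp only [hu]
      exact (MvPolynomial.aeval_algebraMap_apply K x Q).symm
    rw [hQx, hQ, MvPolynomial.eval_monomial, Finsupp.prod_fintype _ _ (fun i => pow_zero _)]
    simp [e, hu]
  · have : Q.coeff e = 0 := by
      by_contra h
      exact not_monomialLT_self _ (hQ' e h)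
    simp [this]
  · have hQf : Q.coeff f = 0 := by
      by_contra h
      exact not_monomialLT_self _ (monomialLT_trans hf (hQ' f h))
    have hef : e ≠ f := by
      rintro rfl
      exact not_monomialLT_self _ hf
    simp [hQf, MvPolynomial.coeff_monomial, hef]

end Laurent

/-! ### From vdim to dimv -/

theorem toLex_zero_lt_smul_iff {n : ℕ} {D : ℤ} (hD : 0 < D) {v : Fin n → ℤ} :
    toLex 0 < toLex (D • v) ↔ toLex 0 < toLex v := by
  change (∃ i, _ ∧ _) ↔ ∃ i, _ ∧ _
  simp [hD, hD.ne', eq_comm]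

theorem toLex_zero_lt_natCast_sub {n : ℕ} {k f : Fin n → ℕ} (h : toLex k < toLex f) :
    toLex (0 : Fin n → ℤ) < toLex ((fun i => (f i : ℤ)) - fun i => (k i : ℤ)) := by
  obtain ⟨i, hi, hlt⟩ := h
  refine ⟨i, fun j hj => ?_, ?_⟩
  · have := hi j hj
    simp only [Pi.toLex_apply] at this
    simp [this]
  · simpa using hlt

/-- Take z_i with exponent the i-th column of N, where M N = D with D > 0; lexicographic positivity
of v then means <_M-positivity of N v. Each z_i is itself positive, so coefficients from R[z]
preserve the positive span, and dividing a lexicographic relation by its smallest term z^k exhibits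
1. -/
theorem one_mem_positiveSpan {R K : Type*} [CommRing R] [CommRing K] [Algebra R K] {n : ℕ}
    {M : Matrix (Fin (n + 1)) (Fin (n + 1)) ℕ} (hM : IsGradedRational M)
    (hdim : ∀ z : Fin (n + 1) → K,
      ringKrullDim (Algebra.adjoin R (Set.range z)) ≤ (n : WithBot ℕ∞))
    (u : Fin (n + 1) → Kˣ) : (1 : K) ∈ positiveSpan R M u := by
  obtain ⟨N, D, hD, hN⟩ := exists_mul_eq_smul_one hM
  have hpos : ∀ v : Fin (n + 1) → ℤ, MonomialLT M 0 (N.mulVec v) ↔ toLex 0 < toLex v := by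
    intro v
    unfold MonomialLT
    rw [Matrix.mulVec_zero, Matrix.mulVec_mulVec, hN, Matrix.smul_mulVec, Matrix.one_mulVec,
      toLex_zero_lt_smul_iff hD]
  let z : Fin (n + 1) → Kˣ := fun i => laurentMonomial u fun j => N j i
  have hz : ∀ f : Fin (n + 1) → ℕ,
      ∏ i, (z i : K) ^ f i = laurentMonomial u (N.mulVec fun i => (f i : ℤ)) := by
    intro f
    rw [← prod_laurentMonomial_pow]
    simp [z]
  have hadj : ∀ y ∈ Set.range fun i => (z i : K),
      ∃ g, MonomialLT M 0 g ∧ (laurentMonomial u g : K) = y := by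
    rintro _ ⟨i, rfl⟩
    refine ⟨fun j => N j i, ?_, rfl⟩
    have h := (hpos (Pi.single i 1)).2
      ⟨i, fun j hj => by simp [(ne_of_lt hj)], by simp⟩
    rwa [Matrix.mulVec_single_one] at h
  obtain ⟨k, hk⟩ := (ringKrullDim_le_iff_forall_mem_lexIdeal _ n).1 (hdim fun i => (z i : K))
    (fun i => ⟨(z i : K), Algebra.subset_adjoin ⟨i, rfl⟩⟩)
  set w : K := ↑(laurentMonomial u (-(N.mulVec fun i => (k i : ℤ))))
  have key : ∀ y ∈ lexIdeal (fun i => (⟨(z i : K), Algebra.subset_adjoin ⟨i, rfl⟩⟩ :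
      Algebra.adjoin R (Set.range fun i => (z i : K)))) k,
      (y : K) * w ∈ positiveSpan R M u := by
    intro y hy
    unfold lexIdeal at hy
    induction hy using Submodule.span_induction with
    | mem y hy =>
      obtain ⟨f, hf, rfl⟩ := hy
      refine Submodule.subset_span
        ⟨N.mulVec ((fun i => (f i : ℤ)) - fun i => (k i : ℤ)), ?_, ?_⟩
      · exact (hpos _).2 (toLex_zero_lt_natCast_sub hf)
      · rw [Matrix.mulVec_sub, sub_eq_add_neg, laurentMonomial_add, Units.val_mul, ← hz]
        simp [w]
    | zero => simp
    | add x y _ _ hx hy => rw [Subalgebra.coe_add, add_mul]; exact add_mem hx hy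
    | smul a x _ hx =>
      rw [smul_eq_mul, Subalgebra.coe_mul, mul_assoc]
      exact mul_mem_positiveSpan_of_mem_adjoin u hadj a.2 hx
  have h := key _ hk
  have hval : ((∏ i, (⟨(z i : K), Algebra.subset_adjoin ⟨i, rfl⟩⟩ :
      Algebra.adjoin R (Set.range fun i => (z i : K))) ^ k i : Algebra.adjoin R _) : K) * w
      = 1 := by
    have : ((∏ i, (⟨(z i : K), Algebra.subset_adjoin ⟨i, rfl⟩⟩ :
      Algebra.adjoin R (Set.range fun i => (z i : K))) ^ k i : Algebra.adjoin R _) : K)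
        = ∏ i, (z i : K) ^ k i := by simp
    rw [this, hz, ← Units.val_mul, ← laurentMonomial_add, add_neg_cancel, laurentMonomial_zero,
      Units.val_one]
  rwa [hval] at h

theorem exists_trailingCoeffOne_of_mem_nonZeroDivisors {R : Type*} [CommRing R] {n : ℕ}
    {M : Matrix (Fin (n + 1)) (Fin (n + 1)) ℕ} (hM : IsGradedRational M)
    (h : VdimLE R (n : ℤ)) (x : Fin (n + 1) → R) (hx : ∀ i, x i ∈ nonZeroDivisors R) :
    ∃ P : MvPolynomial (Fin (n + 1)) R, MvPolynomial.eval x P = 0 ∧ TrailingCoeffOne M P := by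
  have hu : ∀ i, IsUnit (algebraMap R (FractionRing R) (x i)) := fun i =>
    IsLocalization.map_units _ (⟨x i, hx i⟩ : nonZeroDivisors R)
  exact exists_trailingCoeffOne_of_one_mem_positiveSpan (IsFractionRing.injective R _) x
    (fun i => (hu i).unit) (fun i => rfl) (one_mem_positiveSpan hM (fun z => h (n + 1) z) _)

theorem TrailingCoeffOne.monomial_mul {R : Type*} [CommRing R] {n : ℕ}
    {M : Matrix (Fin n) (Fin n) ℕ} {P : MvPolynomial (Fin n) R} (hP : TrailingCoeffOne M P)
    (s : Fin n →₀ ℕ) : TrailingCoeffOne M (MvPolynomial.monomial s 1 * P) := by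
  classical
  obtain ⟨e, he, hf⟩ := hP
  refine ⟨s + e, by rw [MvPolynomial.coeff_monomial_mul, one_mul, he], fun f hlt => ?_⟩
  rw [MvPolynomial.coeff_monomial_mul']
  split_ifs with hs
  · rw [one_mul]
    refine hf _ ?_
    obtain ⟨g, rfl⟩ := le_iff_exists_add.1 hs
    rw [add_tsub_cancel_left]
    have hcast : ∀ a : Fin n →₀ ℕ, (fun i => (((s + a) i : ℕ) : ℤ))
        = (fun i => (s i : ℤ)) + fun i => (a i : ℤ) := by
      intro a
      ext i
      simp
    unfold MonomialLT at hlt ⊢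
    rw [hcast, hcast, Matrix.mulVec_add, Matrix.mulVec_add, toLex_add, toLex_add] at hlt
    exact lt_of_add_lt_add_left hlt
  · rfl

/-- The idempotent e is the support of a: the sum a + (1 - e) is a, regular, on the component e and
1 on the component 1 - e. -/
theorem IsPPRing.exists_isIdempotentElem {R : Type*} [CommRing R] (hR : IsPPRing R) (a : R) :
    ∃ e : R, e * a = a ∧ a + (1 - e) ∈ nonZeroDivisors R := by
  obtain ⟨e, he, hann⟩ := hR a
  have hmem : ∀ y, y * a = 0 ↔ y ∈ Ideal.span {1 - e} := by
    intro y
    rw [← hann, Submodule.mem_annihilator_span_singleton, smul_eq_mul]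
  have hea : (1 - e) * a = 0 := (hmem _).2 (Ideal.mem_span_singleton_self _)
  refine ⟨e, by linear_combination -hea, ?_⟩
  rw [mem_nonZeroDivisors_iff_right]
  intro y hy
  have hee : e * e = e := he
  have h1 : y * a = 0 := by linear_combination e * hy + y * hee + y * hea
  have h2 : y * (1 - e) = 0 := by linear_combination hy - h1
  obtain ⟨c, rfl⟩ := Ideal.mem_span_singleton'.1 ((hmem y).1 h1)
  linear_combination h2 - c * hee

theorem dimvLE_of_vdimLE {R : Type*} [CommRing R] (hR : IsPPRing R)
    (M : ∀ n : ℕ, Matrix (Fin (n + 1)) (Fin (n + 1)) ℕ) (hM : ∀ n, IsGradedRational (M n))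
    (n : ℕ) (h : VdimLE R (n : ℤ)) : DimvLE M R (n : ℤ) := by
  intro x
  choose e he hreg using fun i => hR.exists_isIdempotentElem (x i)
  obtain ⟨P, hP0, hP⟩ := exists_trailingCoeffOne_of_mem_nonZeroDivisors (hM n) h _ hreg
  -- Multiplication by X₀⋯Xₙ absorbs the change from x_i + (1 - e_i) to x_i: each 1 - e_i kills x_i,
  -- so both tuples agree modulo the annihilator of ∏ x_i.
  refine ⟨_, ?_, hP.monomial_mul (Finsupp.equivFunOnFinite.symm fun _ => 1)⟩
  rw [map_mul, MvPolynomial.eval_monomial, Finsupp.prod_fintype _ _ (fun i => pow_zero _)]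
  simp only [Finsupp.coe_equivFunOnFinite_symm, pow_one, one_mul]
  set I := Ideal.span {y : R | y * ∏ i, x i = 0}
  have hI : ∀ y ∈ I, y * ∏ i, x i = 0 := by
    intro y hy
    induction hy using Submodule.span_induction with
    | mem y hy => exact hy
    | zero => simp
    | add a b _ _ ha hb => rw [add_mul, ha, hb, add_zero]
    | smul a b _ hb => rw [smul_eq_mul, mul_assoc, hb, mul_zero]
  have hmk : (fun i => Ideal.Quotient.mk I (x i + (1 - e i)))
      = fun i => Ideal.Quotient.mk I (x i) := by
    ext1 i
    rw [Ideal.Quotient.eq]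
    refine Ideal.subset_span ?_
    rw [Set.mem_ofPred_eq, ← Finset.mul_prod_erase _ _ (Finset.mem_univ i)]
    linear_combination -(∏ j ∈ Finset.univ.erase i, x j) * he i
  have hmem : MvPolynomial.eval x P ∈ I := by
    have h1 := MvPolynomial.aeval_algebraMap_apply (R ⧸ I) x P
    have h2 := MvPolynomial.aeval_algebraMap_apply (R ⧸ I) (fun i => x i + (1 - e i)) P
    rw [← Ideal.Quotient.eq_zero_iff_mem]
    refine h1.symm.trans (Eq.trans ?_ (h2.trans ?_))
    · exact congrArg (fun v => MvPolynomial.aeval v P) hmk.symm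
    · have h3 : MvPolynomial.aeval (fun i => x i + (1 - e i)) P = 0 := hP0
      rw [h3, map_zero]
  rw [mul_comm]
  exact hI _ hmem

theorem lemma3p1 {R : Type*} [CommRing R] (hR : IsPPRing R)
    (M : ∀ n : ℕ, Matrix (Fin (n + 1)) (Fin (n + 1)) ℕ) (hM : ∀ n, IsGradedRational (M n))
    (d : ℤ) (hd : -1 ≤ d) :
    VdimLE R d ↔ DimvLE M R d := by
  match d, hd with
  | Int.ofNat n, _ => exact ⟨dimvLE_of_vdimLE hR M hM n, vdimLE_of_dimvLE M hM n⟩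
  | Int.negSucc 0, _ => exact Iff.rfl
  | Int.negSucc (k + 1), hd => omega
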